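/- Let $N=\{1,\dots,n\}$ with $n\ge 2$, let $1\le\alpha\le k\le n$ and $1\le\beta\le\bar\alpha:=\lceil\log_2\sum_{i=0}^{\alpha}\binom ni\rceil$; $\log$ denotes the natural logarithm. An $[n,m,\gamma]$-BCC-code is a set $C\subseteq\{0,1\}^m$ with $|C|=n$ such that any two distinct subsets of $C$ of size at most $\gamma$ have different bitwise XORs. For a constant $c>0$ put $\gamma=\left\lfloor\frac{\beta-1}{c\log n}\right\rfloor$, and let $\mathsf{BCC}$ assign to the elements of $N$ the words of an $[n,\beta-1,\gamma]$-BCC-code (if $\gamma=0$: arbitrary words of $\beta-1$ bits). The feedback $f_{\alpha,\beta}$ maps a set $X\subseteq N$ with $|X|\le\alpha$ to the $\beta$ bits $(|X|\bmod 2)\,\|\,\bigoplus_{x\in X}\mathsf{BCC}(x)$, the parity of $|X|$ followed by the XOR of the codewords of the elements of $X$. A deterministic (non-adaptive) algorithm of query complexity $t$ is a sequence $Q_1,\dots,Q_t\subseteq N$. For a hidden set $K\subseteq N$, $|K|\le k$, the answer to $Q_i$ is $f_{\alpha,\beta}(Q_i\cap K)$ if $|Q_i\cap K|\le\alpha$;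 otherwise it is $f_{\alpha,\beta}(Y)$ for a set $Y\subseteq N$, $|Y|\le\alpha$, chosen arbitrarily by the $\alpha$-Malicious Adversary (who knows $K$, the whole sequence and $i$). The algorithm solves $(n,k)$-Group-Testing if for all $K_1\ne K_2$ of size at most $k$ the sets of answer vectors that the adversary can produce for $K_1$ and for $K_2$ are disjoint. Theorem. For some constant $c>0$, such an assignment $\mathsf{BCC}$ exists for all $n\ge2$ and $\beta\ge1$. Moreover, for every constant $c>0$, for all $n,k,\alpha,\beta$ as above and every such assignment $\mathsf{BCC}$, under the feedback $f_{\alpha,\beta}$ and the $\alpha$-Malicious Adversary there is a deterministic solution to $(n,k)$-Group-Testing with query complexity $$O\!\left(\frac{k^2}{\alpha\beta}\log n\left(\frac{\beta}{\alpha}+\log n\right)\right)\ \text{ if }\alpha>18\log k,\qquad O\!\left(\frac{k^2}{\alpha}\log\frac{4n}{k}\right)\ \text{ otherwise,}$$ where the constants in $O(\cdot)$ depend only on $c$. In particular, the query complexity of these solutions is $O\!\left(\frac{k^2}{\alpha\beta}\log^2 n\right)$ in the first case and $O\!\left(\frac{k^2}{\alpha\beta}\log^3 n\right)$ in the second. 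-/

import Mathlib

namespace GroupTesting

/-- The possible inputs of a feedback function of capacity `α` over the universe `Fin n`
(`n` elements): the sets of at most `α` elements. -/
abbrev CapSet (n α : ℕ) : Type := {X : Finset (Fin n) // X.card ≤ α}

/-- An `(α, β)`-feedback function: it maps every set of at most `α` elements to `β` bits. -/
abbrev Feedback (n α β : ℕ) : Type := CapSet n α → (Fin β → ZMod 2)

/-- A non-adaptive deterministic algorithm with query complexity `t`: a sequence of `t` queries,
each an arbitrary subset of the universe. -/
abbrev Queries (n t : ℕ) : Type := Fin t → Finset (Fin n)

/-- A function `Adv (X, i)`: it receives a set `X` and the index `i` of a query, and returns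
a set of at most `α` elements. -/
abbrev Strategy (n α t : ℕ) : Type := Finset (Fin n) → Fin t → CapSet n α

/-- An adversary type: the strategies allowed for each query sequence and each hidden set. -/
abbrev Adversary (n α : ℕ) : Type :=
  ∀ t : ℕ, Queries n t → Finset (Fin n) → Set (Strategy n α t)

/-- The `α`-Malicious Adversary. A set of at most `α` elements has to be passed on unchanged; a
larger set may be replaced by an arbitrary set of at most `α` elements of the universe. The choice
may depend on the query sequence, on the hidden set and on the index of the query. -/
def maliciousAdversary (n α : ℕ) : Adversary n α := fun _ _ _ =>
  {adv | ∀ X i, X.card ≤ α → (adv X i : Finset (Fin n)) = X}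

/-- The sequence of the answers to all queries, for the hidden set `K` and the strategy `adv`. -/
def feedbackVector {n α β t : ℕ} (feed : Feedback n α β) (Q : Queries n t)
    (K : Finset (Fin n)) (adv : Strategy n α t) : Fin t → (Fin β → ZMod 2) :=
  fun i => feed (adv (Q i ∩ K) i)

/-- `Q` solves `(n, k)`-Group-Testing: for distinct hidden sets of size at most `k`, the sets of
feedback vectors that the adversary can produce are disjoint. -/
def Solves {n α β t : ℕ} (k : ℕ) (A : Adversary n α) (feed : Feedback n α β)
    (Q : Queries n t) : Prop :=
  ∀ K₁ K₂ : Finset (Fin n), K₁.card ≤ k → K₂.card ≤ k → K₁ ≠ K₂ →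
    Disjoint (feedbackVector feed Q K₁ '' A t Q K₁) (feedbackVector feed Q K₂ '' A t Q K₂)

/-- An `[n, m, γ]`-BCC-code: a set of `n` binary words of length `m` such that distinct subsets
with at most `γ` words have distinct bitwise XORs (XOR is addition modulo 2). -/
def IsBCCCode (n m γ : ℕ) (C : Finset (Fin m → ZMod 2)) : Prop :=
  C.card = n ∧
    ∀ S₁ S₂ : Finset (Fin m → ZMod 2), S₁ ⊆ C → S₂ ⊆ C → S₁.card ≤ γ → S₂.card ≤ γ → S₁ ≠ S₂ →
      ∑ s ∈ S₁, s ≠ ∑ s ∈ S₂, s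

/-- `bcc` assigns to the `n` elements the words of an `[n, m, γ]`-BCC-code. As the code has exactly
`n` words, `bcc` is then injective. For `γ = 0`, where `m` may be too small for `n` distinct words
and XORs of nonempty sets of words carry no guarantee, `bcc` is arbitrary. -/
def IsBCCAssignment {n m : ℕ} (γ : ℕ) (bcc : Fin n → (Fin m → ZMod 2)) : Prop :=
  1 ≤ γ → IsBCCCode n m γ (Finset.univ.image bcc)

/-- The parameter `⌊(β - 1) / (c log n)⌋` of the code used by a feedback with `β` bits. -/
noncomputable def bccRadius (c : ℝ) (n β : ℕ) : ℕ :=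
  ⌊((β : ℝ) - 1) / (c * Real.log n)⌋₊

/-- The feedback of `X`: the parity of `|X|` (bit `0`), followed by the `β - 1` bits of the XOR of
the codewords of the elements of `X`. -/
def abFeed {n : ℕ} (α β : ℕ) (bcc : Fin n → (Fin (β - 1) → ZMod 2)) : Feedback n α β :=
  fun X i =>
    if h : (i : ℕ) = 0 then (X.1.card : ZMod 2)
    else (∑ x ∈ X.1, bcc x) ⟨(i : ℕ) - 1, by have := i.isLt; omega⟩

/-- The maximum expressiveness: the number of bits that encode all sets of at most `α` elements. -/
noncomputable def maxExpressiveness (n α : ℕ) : ℕ :=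
  ⌈Real.logb 2 (∑ i ∈ Finset.range (α + 1), (n.choose i : ℝ))⌉₊

end GroupTesting

/-!
Let `D` be the symmetric difference of two hidden sets. A query tells them apart, whatever the
adversary does, if neither set overflows (meets the query in more than `α` elements) and the query
`Q` detects `D`: `|Q ∩ D|` is odd, so that the parities differ, or it lies between `1` and the
radius `γ` of the code, so that the XORs of the codewords differ (`solves_of_separating`).
Suitable queries are found by the probabilistic method: all queries are independent random sets
with a density `p`, and a weighted union bound (`exists_sequence_prod_lt_one`) is applied. All the
probabilities come from the formula `(1 + p (θ - 1)) ^ |D|` for the expectation of `θ ^ |Q ∩ D|`: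
`θ = -1` gives the parity, `θ = 0` the empty intersection, and `θ > 1` Chernoff's bound.

* The parity alone, with `p = α / (8k)`: a random query separates two given hidden sets with
  probability at least `p / 3`, because adding or removing one element of `D` flips the parity at
  the cost of a factor `p`. As there are at most `(4n / k) ^ (2k)` pairs,
  `O(k² / α * log (4n / k))` queries suffice (`exists_separating_of_parity`). This holds for all
  `α`, and it is used for `α ≤ 18 log k` and when the code has radius zero, where `β = O(log n)`.
* With a code of radius `γ ≥ 1` (cut off at `α`) and `α > 18 log k`, the density is
  `p = γ / (e ^ 15 k)`. A union bound over pairs would be too costly, so overflow and detection are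
  separated: with `s = k / α * log n`, every hidden set overflows in fewer than `s` queries, since
  overflows are exponentially rare in `α`, and every `D` is detected by more than `2s` queries,
  with failure probability at most `n ^ (-3 |D|)`, which is summable over all `D`
  (`exists_rate_detectable`). This takes `O(k² / (α γ) * log n)` queries
  (`exists_separating_of_code`).

The remaining bounds follow from `β = O(γ log n)` and `β = O(α log n)`. The codes exist by the
greedy construction (`exists_sum_ne_zero`).
-/

namespace GroupTesting

/-! ### Random subsets and the first-moment method -/

section RandomSubset

variable {ι : Type*} [Fintype ι] [DecidableEq ι]

/-- The probability of `Q` when every element of `ι` is put into a random set independently with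
probability `p`. -/
def subsetWeight (p : ℝ) (Q : Finset ι) : ℝ := ∏ x, if x ∈ Q then p else 1 - p

/-- The expectation of `φ Q` for the random set `Q` that contains every element of `ι`
independently with probability `p`. Probabilities are expectations of `0`-`1` indicators. -/
def subsetMean (p : ℝ) (φ : Finset ι → ℝ) : ℝ := ∑ Q, subsetWeight p Q * φ Q

lemma subsetWeight_nonneg {p : ℝ} (h0 : 0 ≤ p) (h1 : p ≤ 1) (Q : Finset ι) :
    0 ≤ subsetWeight p Q := by
  refine Finset.prod_nonneg fun x _ => ?_
  split_ifs <;> linarith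

/-- Independence: the expectation of a product of functions of the single elements factors. -/
lemma subsetMean_prod (p : ℝ) (a : ι → ℝ) :
    subsetMean p (fun Q => ∏ x ∈ Q, a x) = ∏ x, (p * a x + (1 - p)) := by
  rw [Fintype.prod_add]
  refine Finset.sum_congr rfl fun Q _ => ?_
  have h : subsetWeight p Q = (∏ x ∈ Q, p) * ∏ x ∈ Qᶜ, (1 - p) := by
    rw [subsetWeight, Finset.prod_ite]
    congr 2 <;> ext x <;> simp
  rw [h, Finset.prod_mul_distrib]
  ring

/-- The moment generating function of the binomial variable `|Q ∩ D|`. -/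
lemma subsetMean_pow_card_inter (p θ : ℝ) (D : Finset ι) :
    subsetMean p (fun Q => θ ^ (Q ∩ D).card) = (1 + p * (θ - 1)) ^ D.card := by
  have h : (fun Q : Finset ι => θ ^ (Q ∩ D).card) =
      fun Q => ∏ x ∈ Q, (if x ∈ D then θ else 1) := by
    funext Q
    rw [Finset.prod_ite_mem, Finset.prod_const]
  rw [h, subsetMean_prod]
  have h2 : ∀ x : ι, p * (if x ∈ D then θ else 1) + (1 - p) =
      if x ∈ D then 1 + p * (θ - 1) else 1 := by
    intro x
    split_ifs <;> ring
  simp_rw [h2]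
  rw [Finset.prod_ite_mem, Finset.prod_const, Finset.univ_inter]

lemma subsetMean_one (p : ℝ) : subsetMean p (fun _ : Finset ι => 1) = 1 := by
  simpa using subsetMean_pow_card_inter p 1 (∅ : Finset ι)

lemma sum_subsetWeight (p : ℝ) : ∑ Q : Finset ι, subsetWeight p Q = 1 := by
  simpa [subsetMean] using subsetMean_one (ι := ι) p

lemma subsetMean_mono {p : ℝ} (h0 : 0 ≤ p) (h1 : p ≤ 1) {φ ψ : Finset ι → ℝ}
    (h : ∀ Q, φ Q ≤ ψ Q) : subsetMean p φ ≤ subsetMean p ψ :=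
  Finset.sum_le_sum fun Q _ => mul_le_mul_of_nonneg_left (h Q) (subsetWeight_nonneg h0 h1 Q)

lemma subsetMean_nonneg {p : ℝ} (h0 : 0 ≤ p) (h1 : p ≤ 1) {φ : Finset ι → ℝ}
    (h : ∀ Q, 0 ≤ φ Q) : 0 ≤ subsetMean p φ :=
  Finset.sum_nonneg fun Q _ => mul_nonneg (subsetWeight_nonneg h0 h1 Q) (h Q)

lemma subsetMean_add (p : ℝ) (φ ψ : Finset ι → ℝ) :
    subsetMean p (fun Q => φ Q + ψ Q) = subsetMean p φ + subsetMean p ψ := by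
  simp [subsetMean, mul_add, Finset.sum_add_distrib]

lemma subsetMean_const_mul (p c : ℝ) (φ : Finset ι → ℝ) :
    subsetMean p (fun Q => c * φ Q) = c * subsetMean p φ := by
  simp only [subsetMean, Finset.mul_sum]
  exact Finset.sum_congr rfl fun Q _ => by ring

lemma subsetMean_const (p c : ℝ) : subsetMean p (fun _ : Finset ι => c) = c := by
  simpa [subsetMean_one] using subsetMean_const_mul p c (fun _ : Finset ι => (1 : ℝ))

lemma subsetMean_add_eq_one (p : ℝ) {φ ψ : Finset ι → ℝ} (h : ∀ Q, φ Q + ψ Q = 1) :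
    subsetMean p φ + subsetMean p ψ = 1 := by
  rw [← subsetMean_add]
  simp_rw [h]
  exact subsetMean_one p

/-- The first-moment method for `t` independent random sets: if the expectations of the products
`b j * ∏ i, φ j (Q i)` add up to less than `1`, some sequence makes all of them less than `1`. -/
lemma exists_sequence_prod_lt_one {J : Type*} (T : Finset J) (b : J → ℝ)
    (φ : J → Finset ι → ℝ) {p : ℝ} (h0 : 0 ≤ p) (h1 : p ≤ 1) (t : ℕ) (hb : ∀ j, 0 ≤ b j)
    (hφ : ∀ j Q, 0 ≤ φ j Q) (h : ∑ j ∈ T, b j * subsetMean p (φ j) ^ t < 1) :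
    ∃ w : Fin t → Finset ι, ∀ j ∈ T, b j * ∏ i, φ j (w i) < 1 := by
  by_contra! hcon
  have hnn : ∀ (w : Fin t → Finset ι) (j : J), 0 ≤ b j * ∏ i, φ j (w i) := fun w j =>
    mul_nonneg (hb j) (Finset.prod_nonneg fun i _ => hφ j _)
  have hge : ∀ w : Fin t → Finset ι, 1 ≤ ∑ j ∈ T, b j * ∏ i, φ j (w i) := by
    intro w
    obtain ⟨j, hj, hj1⟩ := hcon w
    exact hj1.trans (Finset.single_le_sum (f := fun j => b j * ∏ i, φ j (w i))
      (fun j _ => hnn w j) hj)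
  have htot : ∑ w : Fin t → Finset ι, ∏ i, subsetWeight p (w i) = 1 := by
    rw [← Fintype.sum_pow, sum_subsetWeight, one_pow]
  have hle : ∑ w : Fin t → Finset ι, ∏ i, subsetWeight p (w i) ≤
      ∑ w : Fin t → Finset ι, (∏ i, subsetWeight p (w i)) *
        ∑ j ∈ T, b j * ∏ i, φ j (w i) :=
    Finset.sum_le_sum fun w _ => le_mul_of_one_le_right
      (Finset.prod_nonneg fun i _ => subsetWeight_nonneg h0 h1 _) (hge w)
  have heq : ∑ w : Fin t → Finset ι, (∏ i, subsetWeight p (w i)) *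
        ∑ j ∈ T, b j * ∏ i, φ j (w i) = ∑ j ∈ T, b j * subsetMean p (φ j) ^ t := by
    simp_rw [Finset.mul_sum]
    rw [Finset.sum_comm]
    refine Finset.sum_congr rfl fun j _ => ?_
    rw [subsetMean, Fintype.sum_pow, Finset.mul_sum]
    refine Finset.sum_congr rfl fun w _ => ?_
    rw [Finset.prod_mul_distrib]
    ring
  linarith

/-- Chernoff's bound for the upper tail of `|Q ∩ D|`. -/
lemma subsetMean_card_ge_le {p θ : ℝ} (h0 : 0 ≤ p) (h1 : p ≤ 1) (hθ : 1 ≤ θ) (D : Finset ι)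
    (m : ℕ) :
    subsetMean p (fun Q => if m ≤ (Q ∩ D).card then 1 else 0) ≤
      Real.exp (p * (θ - 1) * D.card) / θ ^ m := by
  have hpos : 0 < θ ^ m := by positivity
  rw [le_div_iff₀ hpos, mul_comm, ← subsetMean_const_mul]
  calc subsetMean p (fun Q => θ ^ m * if m ≤ (Q ∩ D).card then 1 else 0)
      ≤ subsetMean p (fun Q => θ ^ (Q ∩ D).card) := by
        refine subsetMean_mono h0 h1 fun Q => ?_
        split_ifs with h
        · simpa using pow_le_pow_right₀ hθ h
        · simp only [mul_zero]; positivity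
    _ = (1 + p * (θ - 1)) ^ D.card := subsetMean_pow_card_inter p θ D
    _ ≤ Real.exp (p * (θ - 1)) ^ D.card := by
        have h2 : 0 ≤ p * (θ - 1) := mul_nonneg h0 (by linarith)
        refine pow_le_pow_left₀ (by linarith) ?_ _
        linarith [Real.add_one_le_exp (p * (θ - 1))]
    _ = Real.exp (p * (θ - 1) * D.card) := by rw [← Real.exp_nat_mul]; ring_nf

lemma subsetMean_inter_empty_le {p : ℝ} (h1 : p ≤ 1) (D : Finset ι) :
    subsetMean p (fun Q => if (Q ∩ D).card = 0 then 1 else 0) ≤ Real.exp (-(D.card * p)) := by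
  have h : (fun Q : Finset ι => if (Q ∩ D).card = 0 then (1 : ℝ) else 0) =
      fun Q => (0 : ℝ) ^ (Q ∩ D).card := by
    funext Q
    by_cases hQ : (Q ∩ D).card = 0 <;> simp [hQ]
  rw [h, subsetMean_pow_card_inter]
  calc (1 + p * (0 - 1)) ^ D.card ≤ Real.exp (-p) ^ D.card := by
        refine pow_le_pow_left₀ (by linarith) ?_ _
        linarith [Real.add_one_le_exp (-p)]
    _ = _ := by rw [← Real.exp_nat_mul]; ring_nf

/-- A random set meets `D` in an odd number of elements with probability
`(1 - (1 - 2p) ^ |D|) / 2`, which is of the order of `p |D|` as long as this is bounded. -/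
lemma le_subsetMean_odd {p : ℝ} (h0 : 0 ≤ p) (h1 : p ≤ 1 / 2) (D : Finset ι)
    (hD : D.card * p ≤ 3) :
    D.card * p / 7 ≤ subsetMean p (fun Q => if Odd (Q ∩ D).card then 1 else 0) := by
  have h : (fun Q : Finset ι => if Odd (Q ∩ D).card then (1 : ℝ) else 0) =
      fun Q => 1 / 2 + (-1 / 2) * (-1 : ℝ) ^ (Q ∩ D).card := by
    funext Q
    split_ifs with hQ
    · rw [hQ.neg_one_pow]; norm_num
    · rw [(Nat.not_odd_iff_even.mp hQ).neg_one_pow]; norm_num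
  rw [h, subsetMean_add, subsetMean_const, subsetMean_const_mul, subsetMean_pow_card_inter]
  set μ : ℝ := D.card * p with hμ
  have hμ0 : 0 ≤ μ := by positivity
  have h2 : (1 + p * (-1 - 1)) ^ D.card ≤ Real.exp (-(2 * μ)) := by
    calc (1 + p * (-1 - 1)) ^ D.card ≤ Real.exp (-(2 * p)) ^ D.card := by
          refine pow_le_pow_left₀ (by linarith) ?_ _
          linarith [Real.add_one_le_exp (-(2 * p))]
      _ = _ := by rw [← Real.exp_nat_mul, hμ]; ring_nf
  have h3 : Real.exp (-(2 * μ)) ≤ 1 / (1 + 2 * μ) := by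
    rw [Real.exp_neg, inv_eq_one_div]
    exact one_div_le_one_div_of_le (by linarith) (by linarith [Real.add_one_le_exp (2 * μ)])
  have h4 : 1 / (1 + 2 * μ) ≤ 1 - 2 * μ / 7 := by
    rw [div_le_iff₀ (by linarith)]
    nlinarith
  generalize (1 + p * (-1 - 1)) ^ D.card = y at h2 ⊢
  linarith

/-- Adding or removing a fixed element `x` changes the parity of `|Q ∩ D|`, for `x ∈ D`, and costs
at most a factor `p` of the weight. So an odd intersection is not much less likely than the
condition that the set `Q \ {x}` meets `U` in fewer than `m` elements. -/
lemma mul_subsetMean_le_odd_and_lt {p : ℝ} (h0 : 0 ≤ p) (h1 : p ≤ 1 / 2) {D : Finset ι} {x : ι}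
    (hx : x ∈ D) (U : Finset ι) (m : ℕ) :
    p * subsetMean p (fun Q => if (Q ∩ U.erase x).card < m then 1 else 0) ≤
      subsetMean p (fun Q => if Odd (Q ∩ D).card ∧ (Q ∩ U.erase x).card < m then 1 else 0) := by
  have hinv : Function.Involutive (fun Q : Finset ι => symmDiff Q {x}) := fun Q => by
    simp
  have hmem : ∀ (Q : Finset ι) (y : ι), y ∈ symmDiff Q {x} ↔ (y ∈ Q ↔ y ≠ x) := by
    intro Q y
    by_cases hy : y = x <;> simp [Finset.mem_symmDiff, hy]
  have hU : ∀ Q : Finset ι, symmDiff Q {x} ∩ U.erase x = Q ∩ U.erase x := by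
    intro Q
    ext y
    simp only [Finset.mem_inter, hmem, Finset.mem_erase]
    tauto
  have hodd : ∀ Q : Finset ι, Odd (symmDiff Q {x} ∩ D).card ↔ ¬ Odd (Q ∩ D).card := by
    intro Q
    by_cases hQ : x ∈ Q
    · have e : symmDiff Q {x} ∩ D = (Q ∩ D).erase x := by
        ext y
        by_cases hy : y = x
        · subst hy; simp [hmem, hQ]
        · simp [hmem, hy]
      rw [e, ← Finset.card_erase_add_one (Finset.mem_inter.2 ⟨hQ, hx⟩)]
      simp [Nat.odd_add_one]
    · have e : symmDiff Q {x} ∩ D = insert x (Q ∩ D) := by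
        ext y
        by_cases hy : y = x
        · subst hy; simp [hmem, hQ, hx]
        · simp [hmem, hy]
      rw [e, Finset.card_insert_of_notMem (by simp [hQ]), Nat.odd_add_one]
  have hw : ∀ Q : Finset ι, p * subsetWeight p (symmDiff Q {x}) ≤ (1 - p) * subsetWeight p Q := by
    intro Q
    unfold subsetWeight
    rw [← Finset.mul_prod_erase _ _ (Finset.mem_univ x),
      ← Finset.mul_prod_erase Finset.univ (fun y => if y ∈ Q then p else 1 - p)
        (Finset.mem_univ x)]
    have e : ∏ y ∈ Finset.univ.erase x, (if y ∈ symmDiff Q {x} then p else 1 - p) =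
        ∏ y ∈ Finset.univ.erase x, (if y ∈ Q then p else 1 - p) := by
      refine Finset.prod_congr rfl fun y hy => ?_
      simp [hmem, Finset.ne_of_mem_erase hy]
    rw [e]
    have hnn : 0 ≤ ∏ y ∈ Finset.univ.erase x, (if y ∈ Q then p else 1 - p) :=
      Finset.prod_nonneg fun y _ => by split_ifs <;> linarith
    rw [← mul_assoc, ← mul_assoc]
    refine mul_le_mul_of_nonneg_right ?_ hnn
    by_cases hQ : x ∈ Q
    · simp [hmem, hQ]; linarith
    · simp only [hmem, hQ, ne_eq, not_true_eq_false, if_true, if_false]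
      nlinarith
  set F : Finset ι → ℝ :=
    fun Q => if Odd (Q ∩ D).card ∧ (Q ∩ U.erase x).card < m then 1 else 0 with hF
  have hsplit : ∀ Q : Finset ι, (if (Q ∩ U.erase x).card < m then (1 : ℝ) else 0) =
      F Q + F (symmDiff Q {x}) := by
    intro Q
    simp only [hF, hU, hodd]
    by_cases h : (Q ∩ U.erase x).card < m <;> by_cases h' : Odd (Q ∩ D).card <;> simp [h, h']
  have hflip : p * subsetMean p (fun Q => F (symmDiff Q {x})) ≤ (1 - p) * subsetMean p F := by
    have e : subsetMean p (fun Q => F (symmDiff Q {x})) =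
        ∑ Q, subsetWeight p (symmDiff Q {x}) * F Q := by
      rw [subsetMean, ← Equiv.sum_comp hinv.toPerm]
      refine Finset.sum_congr rfl fun Q _ => ?_
      simp only [Function.Involutive.coe_toPerm]
      rw [symmDiff_assoc, symmDiff_self, symmDiff_bot]
    rw [e, subsetMean, Finset.mul_sum, Finset.mul_sum]
    refine Finset.sum_le_sum fun Q _ => ?_
    rw [← mul_assoc, ← mul_assoc]
    refine mul_le_mul_of_nonneg_right (hw Q) ?_
    simp only [hF]
    split_ifs <;> norm_num
  simp_rw [hsplit]
  rw [subsetMean_add]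
  linarith

end RandomSubset

/-! ### Codes with distinct XORs of small subsets -/

/-- In a code with the BCC property, the words of a nonempty set of at most `γ` elements have a
nonzero XOR. -/
lemma IsBCCAssignment.sum_ne_zero {n m γ : ℕ} {bcc : Fin n → (Fin m → ZMod 2)}
    (h : IsBCCAssignment γ bcc) {S : Finset (Fin n)} (hS : S.Nonempty) (hγ : S.card ≤ γ) :
    ∑ x ∈ S, bcc x ≠ 0 := by
  obtain ⟨hcard, hsum⟩ := h (hS.card_pos.trans_le hγ)
  have hinj : Function.Injective bcc := by
    rw [← Set.injOn_univ, ← Finset.coe_univ, ← Finset.card_image_iff, hcard]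
    simp
  have := hsum (S.image bcc) ∅ (Finset.image_subset_image (Finset.subset_univ _))
    (Finset.empty_subset _) (Finset.card_image_le.trans hγ) (by simp) (by simpa using hS.ne_empty)
  rwa [Finset.sum_image hinj.injOn, Finset.sum_empty] at this

/-- A set of `n` elements has at most `(n + 1) ^ k` subsets of size at most `k`. -/
lemma sum_range_choose_le_pow (n k : ℕ) :
    ∑ i ∈ Finset.range (k + 1), n.choose i ≤ (n + 1) ^ k := by
  rw [add_pow]
  refine Finset.sum_le_sum fun i hi => ?_
  have hik : i ≤ k := Nat.lt_succ_iff.mp (Finset.mem_range.mp hi)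
  simp only [one_pow, mul_one, Nat.cast_id]
  exact (Nat.choose_le_pow n i).trans (Nat.le_mul_of_pos_right _ (Nat.choose_pos hik))

lemma card_filter_card_le {ι : Type*} [DecidableEq ι] (s : Finset ι) (k : ℕ) :
    (s.powerset.filter fun S => S.card ≤ k).card =
      ∑ i ∈ Finset.range (k + 1), s.card.choose i := by
  rw [Finset.card_eq_sum_card_fiberwise (f := Finset.card) (t := Finset.range (k + 1))]
  · refine Finset.sum_congr rfl fun i hi => ?_
    rw [← Finset.card_powersetCard, Finset.powersetCard_eq_filter, Finset.filter_filter]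
    congr 1
    refine Finset.filter_congr fun S _ => ?_
    have := Finset.mem_range.mp hi
    constructor
    · exact fun h => h.2
    · exact fun h => ⟨by omega, h⟩
  · intro S hS
    have := (Finset.mem_filter.mp hS).2
    simpa using Nat.lt_succ_of_le this

/-- The greedy (Gilbert–Varshamov) construction: a new word only has to avoid the negated sums of
the sets of at most `r` earlier words. -/
lemma exists_sum_ne_zero {ι V : Type*} [DecidableEq ι] [AddCommGroup V] [Fintype V] (r : ℕ)
    (s : Finset ι) (hV : (s.card + 1) ^ r < Fintype.card V) :
    ∃ f : ι → V, ∀ S ⊆ s, S.Nonempty → S.card ≤ r + 1 → ∑ x ∈ S, f x ≠ 0 := by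
  classical
  induction s using Finset.induction_on with
  | empty =>
    refine ⟨fun _ => 0, fun S hS hne => ?_⟩
    rw [Finset.subset_empty.mp hS] at hne
    simp at hne
  | insert a s ha ih =>
    have hle : (s.card + 1) ^ r < Fintype.card V := by
      refine lt_of_le_of_lt (Nat.pow_le_pow_left ?_ r) hV
      rw [Finset.card_insert_of_notMem ha]
      omega
    obtain ⟨f, hf⟩ := ih hle
    obtain ⟨v, hv⟩ : ∃ v, v ∉ (s.powerset.filter fun S => S.card ≤ r).image
        (fun S => -∑ x ∈ S, f x) := by
      by_contra! hall
      have h1 : Fintype.card V ≤ _ := Finset.card_le_card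
        (fun v _ => hall v : (Finset.univ : Finset V) ⊆ _)
      refine absurd (h1.trans (Finset.card_image_le.trans ?_)) (not_le.mpr hle)
      rw [card_filter_card_le]
      exact sum_range_choose_le_pow _ _
    refine ⟨Function.update f a v, fun S hS hne hcard => ?_⟩
    have hupd : ∀ T : Finset ι, a ∉ T → ∑ x ∈ T, Function.update f a v x = ∑ x ∈ T, f x :=
      fun T hT => Finset.sum_congr rfl fun x hx =>
        Function.update_of_ne (ne_of_mem_of_not_mem hx hT) _ _
    by_cases haS : a ∈ S
    · rw [← Finset.add_sum_erase S _ haS, Function.update_self,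
        hupd _ (Finset.notMem_erase a S)]
      intro h0
      refine hv (Finset.mem_image.mpr ⟨S.erase a, ?_, (eq_neg_of_add_eq_zero_left h0).symm⟩)
      rw [Finset.mem_filter, Finset.mem_powerset, Finset.card_erase_of_mem haS]
      exact ⟨fun x hx => Finset.mem_of_mem_insert_of_ne (hS (Finset.mem_of_mem_erase hx))
        (Finset.ne_of_mem_erase hx), by omega⟩
    · rw [hupd S haS]
      exact hf S ((Finset.subset_insert_iff_of_notMem haS).mp hS) hne hcard

/-- In characteristic two, the sums over two sets add up to the sum over their symmetric
difference. -/
lemma sum_add_sum_eq_sum_symmDiff {ι V : Type*} [DecidableEq ι] [AddCommGroup V]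
    (h2 : ∀ v : V, v + v = 0) (S T : Finset ι) (f : ι → V) :
    ∑ x ∈ S, f x + ∑ x ∈ T, f x = ∑ x ∈ symmDiff S T, f x := by
  have hS := Finset.sum_inter_add_sum_sdiff S T f
  have hT := Finset.sum_inter_add_sum_sdiff T S f
  rw [Finset.inter_comm T S] at hT
  rw [symmDiff_def, Finset.sup_eq_union,
    Finset.sum_union (Finset.disjoint_left.mpr fun x hx hx' =>
      (Finset.mem_sdiff.mp hx').2 (Finset.mem_sdiff.mp hx).1), ← hS, ← hT, add_add_add_comm,
    h2, zero_add]

lemma add_self_eq_zero_of_zmod_two {m : ℕ} (v : Fin m → ZMod 2) : v + v = 0 :=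
  funext fun j => CharTwo.add_self_eq_zero (v j)

/-- Words such that all nonempty sets of at most `2γ` of them have a nonzero XOR form a
BCC-code of radius `γ`. -/
lemma isBCCAssignment_of_sum_ne_zero {n m γ : ℕ} {bcc : Fin n → (Fin m → ZMod 2)}
    (h : ∀ S : Finset (Fin n), S.Nonempty → S.card ≤ 2 * γ → ∑ x ∈ S, bcc x ≠ 0) :
    IsBCCAssignment γ bcc := by
  intro hγ
  have hinj : Function.Injective bcc := by
    intro x y hxy
    by_contra hne
    refine h {x, y} ⟨x, by simp⟩ ?_ ?_
    · rw [Finset.card_pair hne]; omega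
    · rw [Finset.sum_pair hne, hxy, add_self_eq_zero_of_zmod_two]
  refine ⟨by rw [Finset.card_image_of_injective _ hinj, Finset.card_univ, Fintype.card_fin], ?_⟩
  intro S₁ S₂ h₁ h₂ hc₁ hc₂ hne heq
  obtain ⟨T₁, -, rfl⟩ := Finset.subset_image_iff.mp h₁
  obtain ⟨T₂, -, rfl⟩ := Finset.subset_image_iff.mp h₂
  rw [Finset.card_image_of_injective _ hinj] at hc₁ hc₂
  rw [Finset.sum_image hinj.injOn, Finset.sum_image hinj.injOn] at heq
  refine h (symmDiff T₁ T₂) ?_ ?_ ?_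
  · rw [Finset.nonempty_iff_ne_empty, ← Finset.bot_eq_empty, Ne, symmDiff_eq_bot]
    rintro rfl
    exact hne rfl
  · have h1 : (symmDiff T₁ T₂).card ≤ (T₁ ∪ T₂).card := Finset.card_le_card symmDiff_le_sup
    have h2 := Finset.card_union_le T₁ T₂
    omega
  · rw [← sum_add_sum_eq_sum_symmDiff add_self_eq_zero_of_zmod_two, heq,
      add_self_eq_zero_of_zmod_two]

/-- BCC-codes of the required radius exist, for the constant `c = 4 / log 2`. -/
lemma exists_isBCCAssignment (n β : ℕ) (hn : 2 ≤ n) (hβ : 1 ≤ β) :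
    ∃ bcc : Fin n → (Fin (β - 1) → ZMod 2),
      IsBCCAssignment (bccRadius (4 / Real.log 2) n β) bcc := by
  set γ := bccRadius (4 / Real.log 2) n β with hγ
  have hn' : (2 : ℝ) ≤ n := by exact_mod_cast hn
  have hlogn : 0 < Real.log n := Real.log_pos (by linarith)
  have hlog2 : 0 < Real.log 2 := Real.log_pos (by norm_num)
  rcases Nat.eq_zero_or_pos γ with h0 | hpos
  · exact ⟨0, fun h => by omega⟩
  have hβ' : ((β - 1 : ℕ) : ℝ) = (β : ℝ) - 1 := by push_cast [Nat.cast_sub hβ]; ring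
  have hle : (γ : ℝ) ≤ ((β : ℝ) - 1) / (4 / Real.log 2 * Real.log n) := by
    refine Nat.floor_le (div_nonneg ?_ (by positivity))
    rw [← hβ']; positivity
  have hle' : 4 * γ * Real.log n ≤ (β - 1 : ℕ) * Real.log 2 := by
    rw [hβ']
    rw [le_div_iff₀ (by positivity)] at hle
    calc 4 * γ * Real.log n = γ * (4 / Real.log 2 * Real.log n) * Real.log 2 := by
          field_simp
      _ ≤ _ := mul_le_mul_of_nonneg_right hle hlog2.le
  have hpow : n ^ (4 * γ) ≤ 2 ^ (β - 1) := by
    have : ((n : ℝ)) ^ (4 * γ) ≤ (2 : ℝ) ^ (β - 1) := by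
      rw [← Real.log_le_log_iff (by positivity) (by positivity), Real.log_pow, Real.log_pow]
      push_cast
      exact hle'
    exact_mod_cast this
  have hlt : (n + 1) ^ (2 * γ - 1) < 2 ^ (β - 1) := by
    calc (n + 1) ^ (2 * γ - 1) < (n + 1) ^ (2 * γ) := Nat.pow_lt_pow_right (by omega) (by omega)
      _ ≤ (n ^ 2) ^ (2 * γ) := Nat.pow_le_pow_left (by nlinarith) _
      _ = n ^ (4 * γ) := by rw [← pow_mul]; congr 1; ring
      _ ≤ _ := hpow
  obtain ⟨f, hf⟩ := exists_sum_ne_zero (V := Fin (β - 1) → ZMod 2) (2 * γ - 1)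
    (Finset.univ : Finset (Fin n)) (by simpa using hlt)
  exact ⟨f, isBCCAssignment_of_sum_ne_zero fun S hS hc =>
    hf S (Finset.subset_univ S) hS (by omega)⟩

/-! ### Separation of hidden sets -/

/-- Two hidden sets are told apart by a query that both of them meet in at most `α` elements, and
whose intersection with their symmetric difference either is odd or is nonempty and within the
radius of the code: there the adversary is powerless, and the two answers differ in the parity or
in the XOR of the codewords. -/
lemma solves_of_separating {n k α β γ t : ℕ} (hβ : 1 ≤ β) {bcc : Fin n → (Fin (β - 1) → ZMod 2)}
    (hbcc : IsBCCAssignment γ bcc) (Q : Queries n t)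
    (h : ∀ K₁ K₂ : Finset (Fin n), K₁.card ≤ k → K₂.card ≤ k → K₁ ≠ K₂ →
      ∃ i, (Q i ∩ K₁).card ≤ α ∧ (Q i ∩ K₂).card ≤ α ∧
        (Odd (Q i ∩ symmDiff K₁ K₂).card ∨
          (Q i ∩ symmDiff K₁ K₂).card ≠ 0 ∧ (Q i ∩ symmDiff K₁ K₂).card ≤ γ)) :
    Solves k (maliciousAdversary n α) (abFeed α β bcc) Q := by
  intro K₁ K₂ hK₁ hK₂ hne
  rw [Set.disjoint_left]
  rintro v ⟨adv₁, hadv₁, rfl⟩ ⟨adv₂, hadv₂, heq⟩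
  obtain ⟨i, h₁, h₂, h₃⟩ := h K₁ K₂ hK₁ hK₂ hne
  have hi := congrFun heq i
  have e₁ : adv₁ (Q i ∩ K₁) i = ⟨Q i ∩ K₁, h₁⟩ := Subtype.ext (hadv₁ _ i h₁)
  have e₂ : adv₂ (Q i ∩ K₂) i = ⟨Q i ∩ K₂, h₂⟩ := Subtype.ext (hadv₂ _ i h₂)
  simp only [feedbackVector, e₁, e₂] at hi
  have hD : symmDiff (Q i ∩ K₂) (Q i ∩ K₁) = Q i ∩ symmDiff K₁ K₂ := by
    rw [symmDiff_comm]
    exact (inf_symmDiff_distrib_left (Q i) K₁ K₂).symm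
  rcases h₃ with hodd | ⟨h0, hγ⟩
  · have hp := congrFun hi ⟨0, hβ⟩
    simp only [abFeed, dif_pos] at hp
    have hs := sum_add_sum_eq_sum_symmDiff (V := ZMod 2) CharTwo.add_self_eq_zero
      (Q i ∩ K₂) (Q i ∩ K₁) (fun _ => 1)
    simp only [Finset.sum_const, nsmul_eq_mul, mul_one, hD, hp, CharTwo.add_self_eq_zero] at hs
    rw [eq_comm, ZMod.natCast_eq_zero_iff_even] at hs
    exact (Nat.not_odd_iff_even.mpr hs) hodd
  · refine hbcc.sum_ne_zero (Finset.card_ne_zero.mp h0) hγ ?_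
    rw [← hD, ← sum_add_sum_eq_sum_symmDiff add_self_eq_zero_of_zmod_two]
    have hs : ∑ x ∈ Q i ∩ K₂, bcc x = ∑ x ∈ Q i ∩ K₁, bcc x := by
      funext j
      have hj := congrFun hi ⟨j + 1, by omega⟩
      simpa [abFeed] using hj
    rw [hs, add_self_eq_zero_of_zmod_two]

/-! ### Counting hidden sets -/

/-- The possible hidden sets: the sets of at most `k` elements. -/
def hiddenSets (n k : ℕ) : Finset (Finset (Fin n)) := Finset.univ.filter fun K => K.card ≤ k

lemma card_hiddenSets (n k : ℕ) :
    (hiddenSets n k).card = ∑ i ∈ Finset.range (k + 1), n.choose i := by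
  have := card_filter_card_le (Finset.univ : Finset (Fin n)) k
  rwa [Finset.powerset_univ, Finset.card_univ, Fintype.card_fin] at this

lemma card_hiddenSets_le_exp {n k : ℕ} (hn : 2 ≤ n) :
    ((hiddenSets n k).card : ℝ) ≤ Real.exp (2 * k * Real.log n) := by
  have h : (hiddenSets n k).card ≤ n ^ (2 * k) := by
    rw [card_hiddenSets, pow_mul]
    exact (sum_range_choose_le_pow n k).trans (Nat.pow_le_pow_left (by nlinarith) k)
  have hn0 : (0 : ℝ) < n := by positivity
  calc ((hiddenSets n k).card : ℝ) ≤ (n : ℝ) ^ (2 * k) := by exact_mod_cast h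
    _ = Real.exp (2 * k * Real.log n) := by
      rw [← Real.exp_log (pow_pos hn0 _), Real.log_pow]; push_cast; ring_nf

/-- The sharper bound `(4n / k) ^ k`, from the binomial theorem for `(1 + k / n) ^ n ≤ e ^ k`. -/
lemma card_hiddenSets_le_exp_log_div {n k : ℕ} (hk : 1 ≤ k) (hkn : k ≤ n) :
    ((hiddenSets n k).card : ℝ) ≤ Real.exp (k * Real.log (4 * (n : ℝ) / k)) := by
  have hk0 : (0 : ℝ) < k := by exact_mod_cast hk
  have hn0 : (0 : ℝ) < n := by exact_mod_cast (by omega : 0 < n)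
  set x : ℝ := k / n with hx
  have hx0 : 0 < x := by positivity
  have hx1 : x ≤ 1 := by rw [hx, div_le_one hn0]; exact_mod_cast hkn
  have h1 : ((hiddenSets n k).card : ℝ) * x ^ k ≤ (1 + x) ^ n := by
    rw [card_hiddenSets, add_comm (1 : ℝ), add_pow]
    push_cast
    rw [Finset.sum_mul]
    calc ∑ i ∈ Finset.range (k + 1), (n.choose i : ℝ) * x ^ k
        ≤ ∑ i ∈ Finset.range (k + 1), x ^ i * 1 ^ (n - i) * (n.choose i : ℝ) := by
          refine Finset.sum_le_sum fun i hi => ?_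
          rw [one_pow, mul_one, mul_comm]
          exact mul_le_mul_of_nonneg_right (pow_le_pow_of_le_one hx0.le hx1
            (Nat.lt_succ_iff.mp (Finset.mem_range.mp hi))) (Nat.cast_nonneg _)
      _ ≤ ∑ i ∈ Finset.range (n + 1), x ^ i * 1 ^ (n - i) * (n.choose i : ℝ) :=
          Finset.sum_le_sum_of_subset_of_nonneg
            (Finset.range_subset_range.mpr (by omega)) fun i _ _ => by positivity
  have h2 : (1 + x) ^ n ≤ 4 ^ k := by
    calc (1 + x) ^ n ≤ Real.exp x ^ n :=
          pow_le_pow_left₀ (by linarith) (by linarith [Real.add_one_le_exp x]) _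
      _ = Real.exp 1 ^ k := by
          rw [← Real.exp_nat_mul, ← Real.exp_nat_mul, hx]
          congr 1
          field_simp
      _ ≤ 4 ^ k := pow_le_pow_left₀ (Real.exp_pos 1).le
          (by linarith [Real.exp_one_lt_d9]) _
  have h3 : Real.exp (k * Real.log (4 * (n : ℝ) / k)) = 4 ^ k / x ^ k := by
    rw [Real.exp_nat_mul, Real.exp_log (by positivity), ← div_pow, hx]
    congr 1
    field_simp
  rw [h3, le_div_iff₀ (by positivity)]
  exact h1.trans h2

/-! ### Queries that separate by parity -/

lemma exp_quarter_le : Real.exp (1 / 4) ≤ 4 / 3 := by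
  have h := Real.add_one_le_exp (-(1 / 4) : ℝ)
  have h2 : Real.exp (1 / 4) * Real.exp (-(1 / 4)) = 1 := by rw [← Real.exp_add]; simp
  nlinarith [Real.exp_pos (1 / 4 : ℝ)]

/-- For two distinct hidden sets, a random query of density `α / (8k)` neither overflows nor has an
even intersection with the symmetric difference with probability at least `α / (24k)`. -/
lemma le_subsetMean_odd_and_card_le {n k α : ℕ} (hα : 1 ≤ α) (hαk : α ≤ k)
    {K₁ K₂ : Finset (Fin n)} (h₁ : K₁.card ≤ k) (h₂ : K₂.card ≤ k) (hne : K₁ ≠ K₂) :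
    (α : ℝ) / (8 * k) / 3 ≤ subsetMean ((α : ℝ) / (8 * k)) (fun Q =>
      if (Q ∩ K₁).card ≤ α ∧ (Q ∩ K₂).card ≤ α ∧ Odd (Q ∩ symmDiff K₁ K₂).card then 1 else 0) := by
  have hα0 : (1 : ℝ) ≤ α := by exact_mod_cast hα
  have hαk' : (α : ℝ) ≤ k := by exact_mod_cast hαk
  have hk0 : (0 : ℝ) < k := by linarith
  set p : ℝ := (α : ℝ) / (8 * k) with hp
  have hp0 : 0 ≤ p := by positivity
  have hp1 : p ≤ 1 / 8 := by
    rw [hp, div_le_iff₀ (by positivity)]; linarith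
  obtain ⟨x, hx⟩ : (symmDiff K₁ K₂).Nonempty := by
    rwa [Finset.nonempty_iff_ne_empty, ← Finset.bot_eq_empty, Ne, symmDiff_eq_bot]
  have hflip := mul_subsetMean_le_odd_and_lt hp0 (by linarith) hx (K₁ ∪ K₂) α
  have htail := subsetMean_card_ge_le (θ := 2) hp0 (by linarith) (by norm_num)
    ((K₁ ∪ K₂).erase x) α
  have hcard : (((K₁ ∪ K₂).erase x).card : ℝ) ≤ 2 * k := by
    have h1 := Finset.card_erase_le (s := K₁ ∪ K₂) (a := x)
    have h2 := Finset.card_union_le K₁ K₂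
    exact_mod_cast (by omega : ((K₁ ∪ K₂).erase x).card ≤ 2 * k)
  have hbound : Real.exp (p * (2 - 1) * ((K₁ ∪ K₂).erase x).card) / 2 ^ α ≤ 2 / 3 := by
    calc Real.exp (p * (2 - 1) * ((K₁ ∪ K₂).erase x).card) / 2 ^ α
        ≤ Real.exp (1 / 4) ^ α / 2 ^ α := by
          refine div_le_div_of_nonneg_right ?_ (by positivity)
          rw [← Real.exp_nat_mul]
          refine Real.exp_le_exp.mpr ?_
          calc p * (2 - 1) * (((K₁ ∪ K₂).erase x).card : ℝ) ≤ p * (2 - 1) * (2 * k) :=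
                mul_le_mul_of_nonneg_left hcard (by linarith)
            _ = α * (1 / 4) := by rw [hp]; field_simp; ring
      _ = (Real.exp (1 / 4) / 2) ^ α := by rw [div_pow]
      _ ≤ (2 / 3) ^ α := pow_le_pow_left₀ (by positivity) (by linarith [exp_quarter_le]) _
      _ ≤ 2 / 3 := pow_le_of_le_one (by norm_num) (by norm_num) (by omega)
  have hcompl : subsetMean p (fun Q : Finset (Fin n) =>
      if (Q ∩ (K₁ ∪ K₂).erase x).card < α then 1 else 0) +
      subsetMean p (fun Q => if α ≤ (Q ∩ (K₁ ∪ K₂).erase x).card then 1 else 0) = 1 := by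
    refine subsetMean_add_eq_one p fun Q => ?_
    by_cases h : (Q ∩ (K₁ ∪ K₂).erase x).card < α
    · simp [h, not_le.mpr h]
    · simp [h, not_lt.mp h]
  have hlt : 1 / 3 ≤ subsetMean p (fun Q : Finset (Fin n) =>
      if (Q ∩ (K₁ ∪ K₂).erase x).card < α then 1 else 0) := by linarith
  have hsub : ∀ (Q K : Finset (Fin n)), K ⊆ K₁ ∪ K₂ →
      (Q ∩ (K₁ ∪ K₂).erase x).card < α → (Q ∩ K).card ≤ α := by
    intro Q K hK hQ
    have h1 : Q ∩ K ⊆ insert x (Q ∩ (K₁ ∪ K₂).erase x) := by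
      intro y hy
      rw [Finset.mem_inter] at hy
      by_cases hyx : y = x
      · simp [hyx]
      · simp only [Finset.mem_insert, Finset.mem_inter, Finset.mem_erase]
        exact Or.inr ⟨hy.1, hyx, hK hy.2⟩
    have h2 := Finset.card_le_card h1
    have h3 := Finset.card_insert_le x (Q ∩ (K₁ ∪ K₂).erase x)
    omega
  have hmono : subsetMean p (fun Q : Finset (Fin n) =>
      if Odd (Q ∩ symmDiff K₁ K₂).card ∧ (Q ∩ (K₁ ∪ K₂).erase x).card < α then 1 else 0) ≤
      subsetMean p (fun Q => if (Q ∩ K₁).card ≤ α ∧ (Q ∩ K₂).card ≤ α ∧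
        Odd (Q ∩ symmDiff K₁ K₂).card then 1 else 0) := by
    refine subsetMean_mono hp0 (by linarith) fun Q => ?_
    by_cases h : Odd (Q ∩ symmDiff K₁ K₂).card ∧ (Q ∩ (K₁ ∪ K₂).erase x).card < α
    · rw [if_pos h, if_pos ⟨hsub Q K₁ Finset.subset_union_left h.2,
        hsub Q K₂ Finset.subset_union_right h.2, h.1⟩]
    · rw [if_neg h]
      split_ifs <;> norm_num
  have := mul_le_mul_of_nonneg_left hlt hp0
  linarith

/-- The parity alone separates all pairs of hidden sets within `O(k² / α * log (4n / k))`
queries: the union bound over the at most `(4n / k) ^ (2k)` pairs. -/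
lemma exists_separating_of_parity {n k α : ℕ} (hα : 1 ≤ α) (hαk : α ≤ k) (hkn : k ≤ n) :
    ∃ (t : ℕ) (Q : Queries n t),
      (∀ K₁ K₂ : Finset (Fin n), K₁.card ≤ k → K₂.card ≤ k → K₁ ≠ K₂ →
        ∃ i, (Q i ∩ K₁).card ≤ α ∧ (Q i ∩ K₂).card ≤ α ∧ Odd (Q i ∩ symmDiff K₁ K₂).card) ∧
      (t : ℝ) ≤ 49 * ((k : ℝ) ^ 2 / α * Real.log (4 * (n : ℝ) / k)) := by
  have hα0 : (1 : ℝ) ≤ α := by exact_mod_cast hα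
  have hαk' : (α : ℝ) ≤ k := by exact_mod_cast hαk
  have hkn' : (k : ℝ) ≤ n := by exact_mod_cast hkn
  have hk0 : (0 : ℝ) < k := by linarith
  set p : ℝ := (α : ℝ) / (8 * k) with hp
  have hp0 : 0 < p := by positivity
  have hp1 : p ≤ 1 / 8 := by
    rw [hp, div_le_iff₀ (by positivity)]; linarith
  set l : ℝ := Real.log (4 * (n : ℝ) / k) with hl
  have hl1 : 1 ≤ l := by
    rw [hl, Real.le_log_iff_exp_le (div_pos (by linarith) hk0), le_div_iff₀ hk0]
    nlinarith [Real.exp_one_lt_d9]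
  set t : ℕ := ⌊6 * k * l / p⌋₊ + 1 with ht
  have ht1 : 6 * k * l < t * p := by
    have := Nat.lt_floor_add_one (6 * k * l / p)
    rw [div_lt_iff₀ hp0] at this
    rw [ht]; push_cast; exact this
  let φ : Finset (Fin n) × Finset (Fin n) → Finset (Fin n) → ℝ := fun j Q =>
    if (Q ∩ j.1).card ≤ α ∧ (Q ∩ j.2).card ≤ α ∧ Odd (Q ∩ symmDiff j.1 j.2).card then 0 else 1
  have hφ0 : ∀ j Q, 0 ≤ φ j Q := fun j Q => by simp only [φ]; split_ifs <;> norm_num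
  set T := (hiddenSets n k ×ˢ hiddenSets n k).filter fun j => j.1 ≠ j.2 with hT
  have hφ : ∀ j ∈ T, subsetMean p (φ j) ≤ Real.exp (-(p / 3)) := by
    intro j hj
    simp only [hT, hiddenSets, Finset.mem_filter, Finset.mem_product, Finset.mem_univ,
      true_and] at hj
    have h := le_subsetMean_odd_and_card_le hα hαk hj.1.1 hj.1.2 hj.2
    have hsum : subsetMean p (φ j) + subsetMean p (fun Q => if (Q ∩ j.1).card ≤ α ∧
        (Q ∩ j.2).card ≤ α ∧ Odd (Q ∩ symmDiff j.1 j.2).card then 1 else 0) = 1 := by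
      refine subsetMean_add_eq_one p fun Q => ?_
      simp only [φ]
      split_ifs <;> norm_num
    linarith [Real.add_one_le_exp (-(p / 3))]
  have htotal : ∑ j ∈ T, 1 * subsetMean p (φ j) ^ t < 1 := by
    calc ∑ j ∈ T, 1 * subsetMean p (φ j) ^ t ≤ ∑ j ∈ T, Real.exp (-(p / 3)) ^ t := by
          refine Finset.sum_le_sum fun j hj => ?_
          rw [one_mul]
          exact pow_le_pow_left₀ (subsetMean_nonneg hp0.le (by linarith) (hφ0 j)) (hφ j hj) t
      _ = T.card * Real.exp (-(t * p / 3)) := by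
          rw [Finset.sum_const, nsmul_eq_mul, ← Real.exp_nat_mul]; ring_nf
      _ ≤ (Real.exp (k * l) * Real.exp (k * l)) * Real.exp (-(t * p / 3)) := by
          refine mul_le_mul_of_nonneg_right ?_ (Real.exp_pos _).le
          have h1 : (T.card : ℝ) ≤ (hiddenSets n k).card * (hiddenSets n k).card := by
            have := Finset.card_filter_le (hiddenSets n k ×ˢ hiddenSets n k)
              (fun j => j.1 ≠ j.2)
            rw [Finset.card_product] at this
            exact_mod_cast this
          have h2 := card_hiddenSets_le_exp_log_div (hα.trans hαk) hkn
          exact h1.trans (mul_le_mul h2 h2 (Nat.cast_nonneg _) (Real.exp_pos _).le)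
      _ = Real.exp (2 * k * l - t * p / 3) := by
          rw [← Real.exp_add, ← Real.exp_add]; ring_nf
      _ < 1 := by rw [Real.exp_lt_one_iff]; linarith
  obtain ⟨w, hw⟩ := exists_sequence_prod_lt_one T (fun _ => 1) φ hp0.le (by linarith) t
    (fun _ => zero_le_one) hφ0 htotal
  refine ⟨t, w, ?_, ?_⟩
  · intro K₁ K₂ h₁ h₂ hne
    by_contra! hcon
    have := hw (K₁, K₂) (by simp [hT, hiddenSets, h₁, h₂, hne])
    rw [Finset.prod_eq_one, mul_one] at this
    · exact lt_irrefl _ this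
    · intro i _
      exact if_neg fun h => hcon i h.1 h.2.1 h.2.2
  · have h1 : (t : ℝ) ≤ 6 * k * l / p + 1 := by
      rw [ht]; push_cast
      linarith [Nat.floor_le (show 0 ≤ 6 * k * l / p by positivity)]
    have h2 : 6 * k * l / p = 48 * ((k : ℝ) ^ 2 / α * l) := by
      rw [hp]; field_simp; ring
    have h3 : 1 ≤ (k : ℝ) ^ 2 / α := by
      rw [le_div_iff₀ (by linarith)]; nlinarith
    nlinarith

/-! ### Queries that separate by parity and codewords -/

/-- The condition on `|Q ∩ D|` under which the feedback detects a symmetric difference `D`: it is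
odd, or it is nonzero and at most the radius `γ` of the code. -/
abbrev Detectable (γ m : ℕ) : Prop := Odd m ∨ m ≠ 0 ∧ m ≤ γ

lemma prod_ite_exp {t : ℕ} (P : Fin t → Prop) [DecidablePred P] (a : ℝ) :
    ∏ i, (if P i then Real.exp a else 1) =
      Real.exp (a * (Finset.univ.filter P).card) := by
  rw [Finset.prod_ite, Finset.prod_const_one, mul_one, Finset.prod_const, ← Real.exp_nat_mul]
  ring_nf

/-- Few detections are unlikely. With `μ = |D| p`, the number of detections has a small
exponential moment: for `μ ≤ 3` because of the parity, at the rate `1`, and for `μ ≥ 3` because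
`|Q ∩ D|` is between `1` and `γ` up to a probability `2 e ^ (-μ)`, at the rate `μ`. The last
inequality is Markov's bound for the probability that at most `2s` of `t` queries detect `D`. -/
lemma exists_rate_detectable {n γ : ℕ} {p : ℝ} (h0 : 0 ≤ p) (h1 : p ≤ 1 / 2)
    {D : Finset (Fin n)} (hD : D.Nonempty) (hDγ : 9 * (D.card * p) ≤ 2 * γ) :
    ∃ l : ℝ, 0 < l ∧ ∀ (t : ℕ) (s : ℝ), 0 ≤ s → 70 * s ≤ t * p →
      Real.exp (2 * s * l) * subsetMean p (fun Q => if Detectable γ (Q ∩ D).card then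
        Real.exp (-l) else 1) ^ t ≤ Real.exp (-(3 * s)) ^ D.card := by
  have hd : (1 : ℝ) ≤ D.card := by exact_mod_cast hD.card_pos
  set d : ℝ := (D.card : ℝ) with hd'
  have hp1 : p ≤ 1 := by linarith
  -- It suffices to bound one exponential moment by `exp (-r)` for a suitable `r`.
  have key : ∀ l r : ℝ, 0 < l → (subsetMean p fun Q : Finset (Fin n) =>
      if Detectable γ (Q ∩ D).card then Real.exp (-l) else 1) ≤ Real.exp (-r) →
      (∀ (t : ℕ) (s : ℝ), 0 ≤ s → 70 * s ≤ t * p → 2 * s * l - t * r ≤ -(3 * s * d)) →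
      ∃ l : ℝ, 0 < l ∧ ∀ (t : ℕ) (s : ℝ), 0 ≤ s → 70 * s ≤ t * p →
        Real.exp (2 * s * l) * subsetMean p (fun Q => if Detectable γ (Q ∩ D).card then
          Real.exp (-l) else 1) ^ t ≤ Real.exp (-(3 * s)) ^ D.card := by
    intro l r hl hmean hle
    refine ⟨l, hl, fun t s hs hst => ?_⟩
    calc Real.exp (2 * s * l) * subsetMean p (fun Q => if Detectable γ (Q ∩ D).card then
          Real.exp (-l) else 1) ^ t
        ≤ Real.exp (2 * s * l) * Real.exp (-r) ^ t := by
          refine mul_le_mul_of_nonneg_left (pow_le_pow_left₀ ?_ hmean t) (Real.exp_pos _).le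
          refine subsetMean_nonneg h0 hp1 fun Q => ?_
          split_ifs
          · exact (Real.exp_pos _).le
          · exact zero_le_one
      _ = Real.exp (2 * s * l - t * r) := by
          rw [← Real.exp_nat_mul, ← Real.exp_add]; ring_nf
      _ ≤ Real.exp (-(3 * s * d)) := Real.exp_le_exp.mpr (hle t s hs hst)
      _ = Real.exp (-(3 * s)) ^ D.card := by
          rw [← Real.exp_nat_mul, hd']; ring_nf
  rcases le_total (d * p) 3 with hμ | hμ
  · refine key 1 (d * p / 14) one_pos ?_ ?_
    · have hodd := le_subsetMean_odd h0 h1 D hμ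
      have he : Real.exp (-1) ≤ 1 / 2 := by
        have h2 : Real.exp 1 * Real.exp (-1) = 1 := by rw [← Real.exp_add]; simp
        nlinarith [Real.exp_one_gt_d9, Real.exp_pos (-1 : ℝ)]
      have hmono : subsetMean p (fun Q : Finset (Fin n) => if Detectable γ (Q ∩ D).card then
            Real.exp (-1) else 1) ≤
          subsetMean p (fun Q => 1 + (-1 / 2) * if Odd (Q ∩ D).card then 1 else 0) := by
        refine subsetMean_mono h0 hp1 fun Q => ?_
        by_cases hQ : Odd (Q ∩ D).card
        · rw [if_pos (Or.inl hQ), if_pos hQ]; linarith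
        · rw [if_neg hQ]
          split_ifs <;> linarith
      rw [subsetMean_add, subsetMean_one, subsetMean_const_mul] at hmono
      have := Real.add_one_le_exp (-(d * p / 14))
      linarith
    · intro t s hs hst
      nlinarith
  · refine key (d * p) (d * p / 2) (by linarith) ?_ ?_
    · have hempty := subsetMean_inter_empty_le hp1 D
      have htail := subsetMean_card_ge_le (θ := Real.exp 2) h0 hp1
        (Real.one_le_exp (by norm_num)) D (γ + 1)
      have htail' : Real.exp (p * (Real.exp 2 - 1) * D.card) / Real.exp 2 ^ (γ + 1) ≤
          Real.exp (-(d * p)) := by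
        rw [← Real.exp_nat_mul, ← Real.exp_sub]
        refine Real.exp_le_exp.mpr ?_
        have he : Real.exp 2 ≤ 9 := by
          have : Real.exp 2 = Real.exp 1 * Real.exp 1 := by rw [← Real.exp_add]; norm_num
          rw [this]
          nlinarith [Real.exp_one_lt_d9, Real.exp_pos (1 : ℝ)]
        have h3 : p * (Real.exp 2 - 1) * D.card ≤ 8 * (d * p) := by
          have h4 := mul_le_mul_of_nonneg_left he (show 0 ≤ d * p by linarith)
          calc p * (Real.exp 2 - 1) * D.card = d * p * Real.exp 2 - d * p := by rw [hd']; ring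
            _ ≤ _ := by linarith
        push_cast
        linarith
      have hmono : subsetMean p (fun Q : Finset (Fin n) => if Detectable γ (Q ∩ D).card then
            Real.exp (-(d * p)) else 1) ≤
          subsetMean p (fun Q => Real.exp (-(d * p)) + ((if (Q ∩ D).card = 0 then 1 else 0) +
            if γ + 1 ≤ (Q ∩ D).card then 1 else 0)) := by
        refine subsetMean_mono h0 hp1 fun Q => ?_
        have hpos := Real.exp_pos (-(d * p))
        by_cases hz : (Q ∩ D).card = 0
        · simp only [hz, if_true]
          split_ifs <;> linarith
        · by_cases hg : γ + 1 ≤ (Q ∩ D).card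
          · rw [if_neg hz, if_pos hg]
            have : Real.exp (-(d * p)) ≤ 1 := Real.exp_le_one_iff.mpr (by linarith)
            split_ifs <;> linarith
          · rw [if_pos (Or.inr ⟨hz, by omega⟩), if_neg hz, if_neg hg]
            linarith
      rw [subsetMean_add, subsetMean_add, subsetMean_const] at hmono
      have h3 : 3 * Real.exp (-(d * p)) ≤ Real.exp (-(d * p / 2)) := by
        have e : Real.exp (-(d * p / 2)) = Real.exp (d * p / 2) * Real.exp (-(d * p)) := by
          rw [← Real.exp_add]; ring_nf
        rw [e]
        refine mul_le_mul_of_nonneg_right ?_ (Real.exp_pos _).le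
        have h5 : Real.exp (d * p / 2) = Real.exp (d * p / 4) * Real.exp (d * p / 4) := by
          rw [← Real.exp_add]; ring_nf
        rw [h5]
        nlinarith [Real.add_one_le_exp (d * p / 4)]
      linarith
    · intro t s hs hst
      have hsd : 0 ≤ s * d := by positivity
      have h3 := mul_le_mul_of_nonneg_right hst (show 0 ≤ d by linarith)
      have h4 := mul_le_mul_of_nonneg_left h1 hsd
      nlinarith

/-- The exponential moment of the overflow indicator, for queries of density at most
`α / (e ^ 15 k)`; the tail bound is Chernoff's with the base `e ^ 15`. -/
lemma subsetMean_overflow_le {n k α : ℕ} {p : ℝ} (h0 : 0 ≤ p) (h1 : p ≤ 1)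
    (hp : p * (Real.exp 15 * k) ≤ α) {K : Finset (Fin n)} (hK : K.card ≤ k) :
    subsetMean p (fun Q => if α < (Q ∩ K).card then Real.exp (8 * α) else 1) ≤
      Real.exp (Real.exp (-(6 * α) - 15)) := by
  have htail := subsetMean_card_ge_le (θ := Real.exp 15) h0 h1
    (Real.one_le_exp (by norm_num)) K (α + 1)
  have hK' : (K.card : ℝ) ≤ k := by exact_mod_cast hK
  have hexp : p * (Real.exp 15 - 1) * K.card ≤ α := by
    calc p * (Real.exp 15 - 1) * (K.card : ℝ) ≤ p * Real.exp 15 * K.card :=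
          mul_le_mul_of_nonneg_right (mul_le_mul_of_nonneg_left (by linarith) h0)
            (Nat.cast_nonneg _)
      _ ≤ p * Real.exp 15 * k := mul_le_mul_of_nonneg_left hK' (by positivity)
      _ ≤ α := by linarith
  have hle : Real.exp (8 * α) * (Real.exp (p * (Real.exp 15 - 1) * K.card) /
      Real.exp 15 ^ (α + 1)) ≤ Real.exp (-(6 * α) - 15) := by
    rw [← Real.exp_nat_mul, ← Real.exp_sub, ← Real.exp_add]
    refine Real.exp_le_exp.mpr ?_
    push_cast
    linarith
  have hmono : subsetMean p (fun Q : Finset (Fin n) =>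
        if α < (Q ∩ K).card then Real.exp (8 * α) else 1) ≤
      subsetMean p (fun Q => 1 + Real.exp (8 * α) * if α + 1 ≤ (Q ∩ K).card then 1 else 0) := by
    refine subsetMean_mono h0 h1 fun Q => ?_
    by_cases hQ : α < (Q ∩ K).card
    · rw [if_pos hQ, if_pos (Nat.succ_le_of_lt hQ)]; linarith
    · rw [if_neg hQ, if_neg (by omega)]; linarith
  rw [subsetMean_add, subsetMean_one, subsetMean_const_mul] at hmono
  have h3 := mul_le_mul_of_nonneg_left htail (Real.exp_pos (8 * α)).le
  have h4 := Real.add_one_le_exp (Real.exp (-(6 * α : ℝ) - 15))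
  linarith

/-- The weights `n ^ (-3 |D|)` of the nonempty sets `D` add up to at most `1 / 3`. -/
lemma sum_nonempty_exp_pow_card_le {n : ℕ} (hn : 2 ≤ n) (T : Finset (Finset (Fin n)))
    (hT : ∀ D ∈ T, D.Nonempty) :
    ∑ D ∈ T, Real.exp (-(3 * Real.log n)) ^ D.card ≤ 1 / 3 := by
  have hn' : (2 : ℝ) ≤ n := by exact_mod_cast hn
  have hn0 : (0 : ℝ) < n := by linarith
  set a : ℝ := Real.exp (-(3 * Real.log n)) with ha
  have ha0 : 0 < a := Real.exp_pos _
  have han : n * a ≤ 1 / 4 := by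
    have h : a * n ^ 3 = 1 := by
      rw [ha, ← Real.exp_log (pow_pos hn0 3), Real.log_pow, ← Real.exp_add]
      simp
    have h4 : (4 : ℝ) ≤ n ^ 2 := by nlinarith
    have h5 := mul_le_mul_of_nonneg_left h4 (mul_pos hn0 ha0).le
    linarith [show n * a * (n : ℝ) ^ 2 = a * n ^ 3 by ring]
  have hall : ∑ D : Finset (Fin n), a ^ D.card = (a + 1) ^ n := by
    simpa using Fintype.sum_pow_mul_eq_add_pow (Fin n) a 1
  have hsub : ∑ D ∈ insert ∅ T, a ^ D.card ≤ ∑ D : Finset (Fin n), a ^ D.card :=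
    Finset.sum_le_sum_of_subset_of_nonneg (Finset.subset_univ _) fun D _ _ => by positivity
  rw [Finset.sum_insert (fun h => Finset.not_nonempty_empty (hT _ h)), hall,
    Finset.card_empty, pow_zero] at hsub
  have hexp : (a + 1) ^ n ≤ Real.exp (1 / 4) := by
    calc (a + 1) ^ n ≤ Real.exp a ^ n :=
          pow_le_pow_left₀ (by linarith) (Real.add_one_le_exp a) _
      _ = Real.exp (n * a) := by rw [← Real.exp_nat_mul]
      _ ≤ _ := Real.exp_le_exp.mpr han
  linarith [exp_quarter_le]

/-- For `α > 18 log k` and a code of radius `γ ≤ α`, random queries of density `γ / (e ^ 15 k)`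
separate all hidden sets within `O(k² / (α γ) * log n)` queries. With `s = k / α * log n`, every
hidden set overflows in fewer than `s` queries, while every symmetric difference is detected by
more than `2s` queries; so for any two hidden sets some detecting query overflows for neither. -/
lemma exists_separating_of_code {n k α γ : ℕ} (hn : 2 ≤ n) (hγ : 1 ≤ γ) (hγα : γ ≤ α)
    (hαk : α ≤ k) (hlog : 18 * Real.log k < (α : ℝ)) :
    ∃ (t : ℕ) (Q : Queries n t),
      (∀ K₁ K₂ : Finset (Fin n), K₁.card ≤ k → K₂.card ≤ k → K₁ ≠ K₂ →
        ∃ i, (Q i ∩ K₁).card ≤ α ∧ (Q i ∩ K₂).card ≤ α ∧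
          Detectable γ (Q i ∩ symmDiff K₁ K₂).card) ∧
      (t : ℝ) ≤ 140 * Real.exp 15 * ((k : ℝ) ^ 2 / (α * γ) * Real.log n) := by
  have hγ0 : (1 : ℝ) ≤ γ := by exact_mod_cast hγ
  have hγα' : (γ : ℝ) ≤ α := by exact_mod_cast hγα
  have hαk' : (α : ℝ) ≤ k := by exact_mod_cast hαk
  have hα0 : (0 : ℝ) < α := by linarith
  have hk0 : (1 : ℝ) ≤ k := by linarith
  have hn' : (2 : ℝ) ≤ n := by exact_mod_cast hn
  set L : ℝ := Real.log n with hL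
  have hL1 : 1 / 2 ≤ L := by
    have h1 := Real.log_le_log (by norm_num) hn'
    linarith [Real.log_two_gt_d9]
  set A : ℝ := Real.exp 15 with hA
  have hA9 : 9 ≤ A := by linarith [Real.add_one_le_exp (15 : ℝ)]
  set p : ℝ := γ / (A * k) with hp
  have hp0 : 0 < p := by positivity
  have hp1 : p ≤ 1 / 2 := by
    rw [hp, div_le_iff₀ (by positivity)]; nlinarith
  have hpA : p * (A * k) = γ := by rw [hp]; field_simp
  set s : ℝ := k / α * L with hs
  have hsα : α * s = k * L := by rw [hs]; field_simp
  have hsL : L ≤ s := by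
    rw [hs]
    exact le_mul_of_one_le_left (by linarith) ((one_le_div hα0).mpr hαk')
  have hs0 : 0 < s := by linarith
  set t : ℕ := ⌈70 * s / p⌉₊ with ht
  have ht1 : 70 * s ≤ t * p := by
    rw [← div_le_iff₀ hp0]; exact Nat.le_ceil _
  have hdiv : 70 * s / p = 70 * A * ((k : ℝ) ^ 2 / (α * γ) * L) := by
    rw [hp, hs]; field_simp
  have hone : 1 ≤ 70 * s / p := by
    rw [le_div_iff₀ hp0]; linarith
  have ht2 : (t : ℝ) ≤ 140 * A * ((k : ℝ) ^ 2 / (α * γ) * L) := by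
    have := Nat.ceil_lt_add_one (show 0 ≤ 70 * s / p by linarith)
    linarith
  -- The exponential moments of the overflows contribute at most a factor `exp s`.
  have hsmall : t * Real.exp (-(6 * α) - 15) ≤ s := by
    have hkexp : (k : ℝ) ≤ Real.exp α := by
      rw [← Real.log_le_iff_le_exp (by linarith)]
      have := Real.log_nonneg hk0
      linarith
    have h1 : (k : ℝ) ^ 2 / (α * γ) * L ≤ Real.exp α * s := by
      have e : (k : ℝ) ^ 2 / (α * γ) * L = k / γ * s := by rw [hs]; field_simp
      rw [e]
      exact mul_le_mul_of_nonneg_right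
        ((div_le_self (by linarith) hγ0).trans hkexp) hs0.le
    have h2 : (140 : ℝ) ≤ Real.exp 5 := by
      have e : Real.exp 5 = Real.exp 1 ^ 5 := by rw [← Real.exp_nat_mul]; norm_num
      rw [e]
      calc (140 : ℝ) ≤ 2.7 ^ 5 := by norm_num
        _ ≤ _ := pow_le_pow_left₀ (by norm_num) (by linarith [Real.exp_one_gt_d9]) _
    have hα1 : (1 : ℝ) ≤ α := by linarith
    calc t * Real.exp (-(6 * α) - 15)
        ≤ (Real.exp 5 * A * (Real.exp α * s)) * Real.exp (-(6 * α) - 15) := by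
          refine mul_le_mul_of_nonneg_right (ht2.trans ?_) (Real.exp_pos _).le
          exact mul_le_mul (mul_le_mul_of_nonneg_right h2 (by linarith)) h1 (by positivity)
            (by positivity)
      _ = Real.exp (5 - 5 * α) * s := by
          have e : Real.exp (5 - 5 * (α : ℝ)) =
              Real.exp 5 * A * Real.exp α * Real.exp (-(6 * α) - 15) := by
            rw [hA, ← Real.exp_add, ← Real.exp_add, ← Real.exp_add]; ring_nf
          rw [e]; ring
      _ ≤ 1 * s := mul_le_mul_of_nonneg_right (Real.exp_le_one_iff.mpr (by linarith)) hs0.le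
      _ = s := one_mul s
  have hrate : ∀ D : Finset (Fin n), D.Nonempty ∧ D.card ≤ 2 * k → ∃ l : ℝ, 0 < l ∧
      Real.exp (2 * s * l) * subsetMean p (fun Q => if Detectable γ (Q ∩ D).card then
        Real.exp (-l) else 1) ^ t ≤ Real.exp (-(3 * s)) ^ D.card := by
    rintro D ⟨hD, hDk⟩
    have hD9 : 9 * (D.card * p) ≤ 2 * γ := by
      have h1 : (D.card : ℝ) ≤ 2 * k := by exact_mod_cast hDk
      calc 9 * (D.card * p) ≤ A * (2 * k * p) :=
            mul_le_mul hA9 (mul_le_mul_of_nonneg_right h1 hp0.le) (by positivity) (by linarith)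
        _ = 2 * γ := by rw [← hpA]; ring
    obtain ⟨l, hl, h⟩ := exists_rate_detectable hp0.le hp1 hD hD9
    exact ⟨l, hl, h t s hs0.le ht1⟩
  choose! l hl0 hl using hrate
  let b : Finset (Fin n) ⊕ Finset (Fin n) → ℝ :=
    Sum.elim (fun _ => Real.exp (-(8 * α * s))) (fun D => Real.exp (2 * s * l D))
  let φ : Finset (Fin n) ⊕ Finset (Fin n) → Finset (Fin n) → ℝ :=
    Sum.elim (fun K Q => if α < (Q ∩ K).card then Real.exp (8 * α) else 1)
      (fun D Q => if Detectable γ (Q ∩ D).card then Real.exp (-l D) else 1)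
  set T : Finset (Finset (Fin n)) := Finset.univ.filter fun D => D.Nonempty ∧ D.card ≤ 2 * k
    with hT
  have hb : ∀ j, 0 ≤ b j := by
    rintro (K | D) <;> exact (Real.exp_pos _).le
  have hφ : ∀ j Q, 0 ≤ φ j Q := by
    rintro (K | D) Q <;> simp only [φ, Sum.elim_inl, Sum.elim_inr] <;> split_ifs <;> positivity
  have hover : ∑ K ∈ hiddenSets n k, b (Sum.inl K) * subsetMean p (φ (Sum.inl K)) ^ t ≤
      1 / 3 := by
    have hterm : ∀ K ∈ hiddenSets n k, b (Sum.inl K) * subsetMean p (φ (Sum.inl K)) ^ t ≤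
        Real.exp (-(8 * α * s)) * Real.exp s := by
      intro K hK
      refine mul_le_mul_of_nonneg_left ?_ (Real.exp_pos _).le
      have h1 := subsetMean_overflow_le (n := n) (α := α) hp0.le (by linarith)
        (by rw [hpA]; exact hγα') (Finset.mem_filter.mp hK).2
      calc subsetMean p (φ (Sum.inl K)) ^ t
          ≤ Real.exp (Real.exp (-(6 * α) - 15)) ^ t :=
            pow_le_pow_left₀ (subsetMean_nonneg hp0.le (by linarith) (hφ _)) h1 t
        _ = Real.exp (t * Real.exp (-(6 * α) - 15)) := by rw [← Real.exp_nat_mul]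
        _ ≤ Real.exp s := Real.exp_le_exp.mpr hsmall
    have hskL : s ≤ k * L := by
      rw [← hsα]; exact le_mul_of_one_le_left hs0.le (by linarith)
    have hkL : 1 / 2 ≤ k * L := by nlinarith
    calc _ ≤ ∑ K ∈ hiddenSets n k, Real.exp (-(8 * α * s)) * Real.exp s :=
          Finset.sum_le_sum hterm
      _ = (hiddenSets n k).card * Real.exp (-(8 * (k * L)) + s) := by
          rw [Finset.sum_const, nsmul_eq_mul, ← Real.exp_add, ← hsα]; ring_nf
      _ ≤ Real.exp (2 * k * L) * Real.exp (-(8 * (k * L)) + s) :=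
          mul_le_mul_of_nonneg_right (card_hiddenSets_le_exp hn) (Real.exp_pos _).le
      _ = Real.exp (-(6 * (k * L)) + s) := by rw [← Real.exp_add]; ring_nf
      _ ≤ Real.exp (-2) := Real.exp_le_exp.mpr (by linarith)
      _ ≤ 1 / 3 := by
          rw [Real.exp_neg, inv_eq_one_div]
          exact one_div_le_one_div_of_le (by norm_num) (by linarith [Real.add_one_le_exp (2 : ℝ)])
  have hdet : ∑ D ∈ T, b (Sum.inr D) * subsetMean p (φ (Sum.inr D)) ^ t ≤ 1 / 3 := by
    refine le_trans (Finset.sum_le_sum fun D hD => ?_)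
      (sum_nonempty_exp_pow_card_le hn T fun D hD => (Finset.mem_filter.mp hD).2.1)
    refine (hl D (Finset.mem_filter.mp hD).2).trans
      (pow_le_pow_left₀ (Real.exp_pos _).le (Real.exp_le_exp.mpr ?_) _)
    linarith
  obtain ⟨w, hw⟩ := exists_sequence_prod_lt_one ((hiddenSets n k).disjSum T) b φ hp0.le
    (by linarith) t hb hφ (by rw [Finset.sum_disjSum]; linarith)
  refine ⟨t, w, ?_, ht2⟩
  have hfew : ∀ K : Finset (Fin n), K.card ≤ k →
      ((Finset.univ.filter fun i => α < (w i ∩ K).card).card : ℝ) < s := by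
    intro K hK
    have h := hw (Sum.inl K) (by simp [hiddenSets, hK])
    simp only [b, φ, Sum.elim_inl] at h
    rw [prod_ite_exp, ← Real.exp_add, Real.exp_lt_one_iff] at h
    have h8 : (0 : ℝ) < 8 * α := by positivity
    nlinarith
  intro K₁ K₂ h₁ h₂ hne
  set D := symmDiff K₁ K₂ with hD
  have hDne : D.Nonempty := by
    rwa [Finset.nonempty_iff_ne_empty, ← Finset.bot_eq_empty, Ne, symmDiff_eq_bot]
  have hDk : D.card ≤ 2 * k := by
    have h3 : D.card ≤ (K₁ ∪ K₂).card := Finset.card_le_card symmDiff_le_sup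
    have h4 := Finset.card_union_le K₁ K₂
    omega
  have hmany : 2 * s <
      ((Finset.univ.filter fun i => Detectable γ (w i ∩ D).card).card : ℝ) := by
    have h := hw (Sum.inr D) (by simp [hT, hDne, hDk])
    simp only [b, φ, Sum.elim_inr] at h
    rw [prod_ite_exp, ← Real.exp_add, Real.exp_lt_one_iff] at h
    have hlD := hl0 D ⟨hDne, hDk⟩
    nlinarith
  by_contra! hcon
  have hsub : (Finset.univ.filter fun i => Detectable γ (w i ∩ D).card) ⊆
      (Finset.univ.filter fun i => α < (w i ∩ K₁).card) ∪
        (Finset.univ.filter fun i => α < (w i ∩ K₂).card) := by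
    intro i hi
    simp only [Finset.mem_union, Finset.mem_filter, Finset.mem_univ, true_and] at hi ⊢
    by_contra! hi'
    exact absurd hi (by simpa [Detectable] using hcon i hi'.1 hi'.2)
  have hc := (Finset.card_le_card hsub).trans (Finset.card_union_le _ _)
  have hc' : ((Finset.univ.filter fun i => Detectable γ (w i ∩ D).card).card : ℝ) ≤
      (Finset.univ.filter fun i => α < (w i ∩ K₁).card).card +
        (Finset.univ.filter fun i => α < (w i ∩ K₂).card).card := by exact_mod_cast hc
  linarith [hfew K₁ h₁, hfew K₂ h₂]

/-! ### The query complexity -/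

lemma half_le_log {n : ℕ} (hn : 2 ≤ n) : 1 / 2 ≤ Real.log n := by
  have h := Real.log_le_log (by norm_num) (by exact_mod_cast hn : (2 : ℝ) ≤ n)
  linarith [Real.log_two_gt_d9]

lemma maxExpressiveness_le {n α : ℕ} (hn : 2 ≤ n) (hα : 1 ≤ α) :
    (maxExpressiveness n α : ℝ) ≤ 5 * α * Real.log n := by
  have hn0 : (0 : ℝ) < n := by positivity
  have hα0 : (1 : ℝ) ≤ α := by exact_mod_cast hα
  set S : ℝ := ∑ i ∈ Finset.range (α + 1), (n.choose i : ℝ) with hS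
  have hS1 : 1 ≤ S := by
    rw [hS, Finset.sum_range_succ']
    have : 0 ≤ ∑ i ∈ Finset.range α, (n.choose (i + 1) : ℝ) :=
      Finset.sum_nonneg fun i _ => Nat.cast_nonneg _
    simpa using this
  have hSle : S ≤ (n : ℝ) ^ (2 * α) := by
    have h1 : ∑ i ∈ Finset.range (α + 1), n.choose i ≤ n ^ (2 * α) := by
      rw [pow_mul]
      exact (sum_range_choose_le_pow n α).trans (Nat.pow_le_pow_left (by nlinarith) α)
    rw [hS]
    exact_mod_cast h1
  have hlogS : Real.log S ≤ 2 * α * Real.log n := by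
    have h1 := Real.log_le_log (by linarith) hSle
    rw [Real.log_pow] at h1
    push_cast at h1
    exact h1
  have hL := half_le_log hn
  have hαL : 1 / 2 ≤ α * Real.log n := by nlinarith
  have hlogb : Real.logb 2 S ≤ 3 * (α * Real.log n) := by
    rw [Real.logb, div_le_iff₀ (Real.log_pos (by norm_num))]
    nlinarith [Real.log_two_gt_d9]
  have hceil := Nat.ceil_lt_add_one (Real.logb_nonneg (by norm_num : (1 : ℝ) < 2) hS1)
  rw [maxExpressiveness, ← hS]
  linarith

lemma log_four_mul_div_le {n k : ℕ} (hn : 2 ≤ n) (hk : 1 ≤ k) :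
    Real.log (4 * (n : ℝ) / k) ≤ 3 * Real.log n := by
  have hn' : (2 : ℝ) ≤ n := by exact_mod_cast hn
  have hk' : (1 : ℝ) ≤ k := by exact_mod_cast hk
  have h : 4 * (n : ℝ) / k ≤ (n : ℝ) ^ 3 := by
    refine (div_le_self (by positivity) hk').trans ?_
    nlinarith [mul_le_mul hn' hn' (by norm_num) (by linarith : (0 : ℝ) ≤ n)]
  have h1 := Real.log_le_log (by positivity) h
  rw [Real.log_pow] at h1
  exact_mod_cast h1

/-- The number of bits is `O(log n)` times the radius of the code (or `O(log n)`, if the radius is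
zero). -/
lemma le_bccRadius_mul_log {c : ℝ} (hc : 0 < c) {n β : ℕ} (hn : 2 ≤ n) :
    (β : ℝ) ≤ (2 + c) * ((bccRadius c n β : ℝ) + 1) * Real.log n := by
  have hL := half_le_log hn
  have h := Nat.lt_floor_add_one (((β : ℝ) - 1) / (c * Real.log n))
  rw [div_lt_iff₀ (by positivity)] at h
  have h0 : (0 : ℝ) ≤ bccRadius c n β := Nat.cast_nonneg _
  change (β : ℝ) - 1 < ((bccRadius c n β : ℝ) + 1) * _ at h
  nlinarith

/-- The solution for small capacities uses the parity bit only; the bounds follow from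
`β = O(α log n)` and `α = O(log k)`. -/
lemma exists_solves_of_le_log {n k α β γ : ℕ} (hn : 2 ≤ n) (hα : 1 ≤ α) (hαk : α ≤ k)
    (hkn : k ≤ n) (hβ : 1 ≤ β) (hβmax : β ≤ maxExpressiveness n α)
    {bcc : Fin n → (Fin (β - 1) → ZMod 2)} (hbcc : IsBCCAssignment γ bcc)
    (hlog : (α : ℝ) ≤ 18 * Real.log k) {C : ℝ} (hC : 13230 ≤ C) :
    ∃ (t : ℕ) (Q : Queries n t),
      Solves k (maliciousAdversary n α) (abFeed α β bcc) Q ∧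
      (t : ℝ) ≤ C * ((k : ℝ) ^ 2 / α * Real.log (4 * (n : ℝ) / k)) ∧
      (t : ℝ) ≤ C * ((k : ℝ) ^ 2 / ((α : ℝ) * β) * Real.log n ^ 3) := by
  obtain ⟨t, Q, hQ, ht⟩ := exists_separating_of_parity hα hαk hkn
  have hα0 : (1 : ℝ) ≤ α := by exact_mod_cast hα
  have hβ0 : (1 : ℝ) ≤ β := by exact_mod_cast hβ
  have hαk' : (α : ℝ) ≤ k := by exact_mod_cast hαk
  have hkn' : (k : ℝ) ≤ n := by exact_mod_cast hkn
  have hk0 : (0 : ℝ) < k := by linarith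
  refine ⟨t, Q, solves_of_separating hβ hbcc Q fun K₁ K₂ h₁ h₂ hne => ?_, ?_, ?_⟩
  · obtain ⟨i, hi₁, hi₂, hi⟩ := hQ K₁ K₂ h₁ h₂ hne
    exact ⟨i, hi₁, hi₂, Or.inl hi⟩
  · have hl0 : 0 ≤ Real.log (4 * (n : ℝ) / k) :=
      Real.log_nonneg ((one_le_div hk0).mpr (by linarith))
    exact ht.trans (mul_le_mul_of_nonneg_right (by linarith) (by positivity))
  · have hl := log_four_mul_div_le hn (hα.trans hαk)
    have hL := half_le_log hn
    have hlogk : Real.log k ≤ Real.log n := Real.log_le_log hk0 hkn'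
    have hβ' : (β : ℝ) ≤ 90 * Real.log n ^ 2 := by
      have h1 : (β : ℝ) ≤ maxExpressiveness n α := by exact_mod_cast hβmax
      have h2 := maxExpressiveness_le hn hα
      nlinarith
    set L := Real.log n
    calc (t : ℝ) ≤ 49 * ((k : ℝ) ^ 2 / α * Real.log (4 * (n : ℝ) / k)) := ht
      _ ≤ 49 * ((k : ℝ) ^ 2 / α * (3 * L)) := by gcongr
      _ = 147 * ((k : ℝ) ^ 2 / (α * β) * (L * β)) := by field_simp; norm_num
      _ ≤ 147 * ((k : ℝ) ^ 2 / (α * β) * (L * (90 * L ^ 2))) := by gcongr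
      _ = 13230 * ((k : ℝ) ^ 2 / (α * β) * L ^ 3) := by ring
      _ ≤ _ := mul_le_mul_of_nonneg_right hC (by positivity)

/-- The solution for large capacities. A code of radius zero means `β = O(log n)`, and then the
parity bit suffices; otherwise the radius of the code, cut off at `α`, is used. -/
lemma exists_solves_of_log_lt {n k α β : ℕ} {c : ℝ} (hc : 0 < c) (hn : 2 ≤ n) (hα : 1 ≤ α)
    (hαk : α ≤ k) (hkn : k ≤ n) (hβ : 1 ≤ β) {bcc : Fin n → (Fin (β - 1) → ZMod 2)}
    (hbcc : IsBCCAssignment (bccRadius c n β) bcc) (hlog : 18 * Real.log k < (α : ℝ)) :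
    ∃ (t : ℕ) (Q : Queries n t),
      Solves k (maliciousAdversary n α) (abFeed α β bcc) Q ∧
      (t : ℝ) ≤ 280 * Real.exp 15 * (2 + c) * ((k : ℝ) ^ 2 / ((α : ℝ) * β) * Real.log n *
        ((β : ℝ) / α + Real.log n)) := by
  have hα0 : (1 : ℝ) ≤ α := by exact_mod_cast hα
  have hβ0 : (1 : ℝ) ≤ β := by exact_mod_cast hβ
  have hαk' : (α : ℝ) ≤ k := by exact_mod_cast hαk
  have hk0 : (0 : ℝ) < k := by linarith
  have hL := half_le_log hn
  have hβγ := le_bccRadius_mul_log hc (β := β) hn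
  have hl := log_four_mul_div_le hn (hα.trans hαk)
  have he : 1 ≤ Real.exp 15 := Real.one_le_exp (by norm_num)
  set γ := bccRadius c n β
  set L := Real.log n
  rcases Nat.eq_zero_or_pos γ with h0 | hpos
  · obtain ⟨t, Q, hQ, ht⟩ := exists_separating_of_parity hα hαk hkn
    refine ⟨t, Q, solves_of_separating hβ hbcc Q fun K₁ K₂ h₁ h₂ hne => ?_, ?_⟩
    · obtain ⟨i, hi₁, hi₂, hi⟩ := hQ K₁ K₂ h₁ h₂ hne
      exact ⟨i, hi₁, hi₂, Or.inl hi⟩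
    · rw [h0, Nat.cast_zero, zero_add, mul_one] at hβγ
      calc (t : ℝ) ≤ 49 * ((k : ℝ) ^ 2 / α * Real.log (4 * (n : ℝ) / k)) := ht
        _ ≤ 49 * ((k : ℝ) ^ 2 / α * (3 * L)) := by gcongr
        _ = 147 * ((k : ℝ) ^ 2 / (α * β) * (L * β)) := by field_simp; norm_num
        _ ≤ 147 * ((k : ℝ) ^ 2 / (α * β) * (L * ((2 + c) * L))) := by gcongr
        _ = 147 * 1 * (2 + c) * ((k : ℝ) ^ 2 / (α * β) * L * (0 + L)) := by ring
        _ ≤ 280 * Real.exp 15 * (2 + c) * ((k : ℝ) ^ 2 / ((α : ℝ) * β) * L *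
            ((β : ℝ) / α + L)) := by
          gcongr
          · norm_num
          · positivity
  · obtain ⟨t, Q, hQ, ht⟩ := exists_separating_of_code hn (γ := min γ α) (le_min hpos hα)
      (min_le_right _ _) hαk hlog
    refine ⟨t, Q, solves_of_separating hβ hbcc Q fun K₁ K₂ h₁ h₂ hne => ?_, ?_⟩
    · obtain ⟨i, hi₁, hi₂, hi⟩ := hQ K₁ K₂ h₁ h₂ hne
      exact ⟨i, hi₁, hi₂, hi.imp_right fun h => ⟨h.1, h.2.trans (min_le_left _ _)⟩⟩
    · have hγ0 : (1 : ℝ) ≤ γ := by exact_mod_cast hpos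
      have hβγ' : (β : ℝ) ≤ 2 * (2 + c) * γ * L := by
        refine hβγ.trans (mul_le_mul_of_nonneg_right ?_ (by linarith))
        nlinarith
      have hinv : (β : ℝ) / (min γ α : ℕ) ≤ 2 * (2 + c) * (β / α + L) := by
        have h4 : 1 ≤ 2 * (2 + c) := by linarith
        have hβα : 0 ≤ (β : ℝ) / α := by positivity
        rcases le_total γ α with h | h
        · rw [min_eq_left h, div_le_iff₀ (by linarith)]
          nlinarith [mul_nonneg hβα (by linarith : (0 : ℝ) ≤ γ)]
        · rw [min_eq_right h]
          nlinarith
      have hg : (0 : ℝ) < (min γ α : ℕ) := by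
        exact_mod_cast lt_min hpos hα
      calc (t : ℝ) ≤ 140 * Real.exp 15 * ((k : ℝ) ^ 2 / (α * (min γ α : ℕ)) * L) := ht
        _ = 140 * Real.exp 15 * ((k : ℝ) ^ 2 / (α * β) * L * (β / (min γ α : ℕ))) := by
          field_simp
        _ ≤ 140 * Real.exp 15 * ((k : ℝ) ^ 2 / (α * β) * L * (2 * (2 + c) * (β / α + L))) := by
          gcongr
        _ = _ := by ring

end GroupTesting

theorem theorem3 :
    (∃ c : ℝ, 0 < c ∧ ∀ n β : ℕ, 2 ≤ n → 1 ≤ β →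
      ∃ bcc : Fin n → (Fin (β - 1) → ZMod 2),
        GroupTesting.IsBCCAssignment (GroupTesting.bccRadius c n β) bcc) ∧
    ∀ c : ℝ, 0 < c → ∃ C : ℝ, 0 < C ∧
      ∀ n k α β : ℕ, 2 ≤ n → 1 ≤ α → α ≤ k → k ≤ n →
        1 ≤ β → β ≤ GroupTesting.maxExpressiveness n α →
        ∀ bcc : Fin n → (Fin (β - 1) → ZMod 2),
          GroupTesting.IsBCCAssignment (GroupTesting.bccRadius c n β) bcc →
          (18 * Real.log k < (α : ℝ) →
            ∃ (t : ℕ) (Q : GroupTesting.Queries n t),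
              GroupTesting.Solves k (GroupTesting.maliciousAdversary n α)
                (GroupTesting.abFeed α β bcc) Q ∧
              (t : ℝ) ≤ C * ((k : ℝ) ^ 2 / ((α : ℝ) * (β : ℝ)) * Real.log n *
                ((β : ℝ) / (α : ℝ) + Real.log n)) ∧
              (t : ℝ) ≤ C * ((k : ℝ) ^ 2 / ((α : ℝ) * (β : ℝ)) * Real.log n ^ 2)) ∧
          ((α : ℝ) ≤ 18 * Real.log k →
            ∃ (t : ℕ) (Q : GroupTesting.Queries n t),
              GroupTesting.Solves k (GroupTesting.maliciousAdversary n α)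
                (GroupTesting.abFeed α β bcc) Q ∧
              (t : ℝ) ≤ C * ((k : ℝ) ^ 2 / (α : ℝ) * Real.log (4 * (n : ℝ) / (k : ℝ))) ∧
              (t : ℝ) ≤ C * ((k : ℝ) ^ 2 / ((α : ℝ) * (β : ℝ)) * Real.log n ^ 3)) := by
  refine ⟨⟨4 / Real.log 2, div_pos (by norm_num) (Real.log_pos (by norm_num)),
    GroupTesting.exists_isBCCAssignment⟩, fun c hc => ?_⟩
  set C₀ : ℝ := 280 * Real.exp 15 * (2 + c) with hC₀
  have hC₀_ge : 8960 ≤ C₀ := by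
    nlinarith [Real.add_one_le_exp (15 : ℝ)]
  refine ⟨6 * C₀, by linarith, fun n k α β hn hα hαk hkn hβ hβmax bcc hbcc => ⟨fun hlog => ?_,
    fun hlog => GroupTesting.exists_solves_of_le_log hn hα hαk hkn hβ hβmax hbcc hlog
      (by linarith)⟩⟩
  obtain ⟨t, Q, hQ, ht⟩ :=
    GroupTesting.exists_solves_of_log_lt hc hn hα hαk hkn hβ hbcc hlog
  have hL := GroupTesting.half_le_log hn
  have hα0 : (0 : ℝ) < α := by exact_mod_cast hα
  refine ⟨t, Q, hQ, ht.trans ?_, ht.trans ?_⟩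
  · refine mul_le_mul_of_nonneg_right ?_ (by positivity)
    linarith
  · -- `β ≤ 5 α log n` turns the second factor into a multiple of `log n`.
    have hβα : (β : ℝ) / α ≤ 5 * Real.log n := by
      rw [div_le_iff₀ hα0]
      have h1 : (β : ℝ) ≤ GroupTesting.maxExpressiveness n α := by exact_mod_cast hβmax
      linarith [GroupTesting.maxExpressiveness_le hn hα]
    calc C₀ * ((k : ℝ) ^ 2 / (α * β) * Real.log n * (β / α + Real.log n))
        ≤ C₀ * ((k : ℝ) ^ 2 / (α * β) * Real.log n * (5 * Real.log n + Real.log n)) := by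
          gcongr
      _ = 6 * C₀ * ((k : ℝ) ^ 2 / (α * β) * Real.log n ^ 2) := by ring
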